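/- All graphs are finite, simple and undirected. Write $\rho(G)$ for the largest eigenvalue of the adjacency matrix of $G$, $K_m$ for the complete graph on $m$ vertices, $mK_1$ for the edgeless graph on $m$ vertices, $\cup$ for disjoint union, and $G_1\vee G_2$ for the join, obtained from $G_1\cup G_2$ by adding all edges between $G_1$ and $G_2$. **Theorem 1.** Let $k\ge 0$ be an integer and let $G$ be a graph of order $n\ge 5k+6$, where $n\equiv k \pmod 2$. If $\rho(G)\ge\rho(K_2\vee((k+1)K_1\cup K_{n-k-3}))$, then every edge of $G$ is contained in a matching of $G$ with exactly $\frac{n-k}{2}$ edges, unless $G\cong K_2\vee((k+1)K_1\cup K_{n-k-3})$. -/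

import Mathlib

/-- The join `G ∨ H`: the disjoint union of `G` and `H` together with all edges between a vertex
of `G` and a vertex of `H`. -/
def graphJoin {V W : Type*} (G : SimpleGraph V) (H : SimpleGraph W) : SimpleGraph (V ⊕ W) :=
  SimpleGraph.sum G H ⊔ completeBipartiteGraph V W

open Classical in
/-- The spectral radius `ρ(G)`: the largest eigenvalue of the adjacency matrix of `G`
(the spectrum is a finite set of reals, non-empty when `V` is; see
`isGreatest_graphSpectralRadius`). -/
noncomputable def graphSpectralRadius {V : Type*} [Fintype V] (G : SimpleGraph V) : ℝ :=
  sSup (spectrum ℝ (G.adjMatrix ℝ))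

open Classical in
theorem isGreatest_graphSpectralRadius {V : Type*} [Fintype V] [Nonempty V]
    (G : SimpleGraph V) :
    IsGreatest {μ : ℝ | Module.End.HasEigenvalue (Matrix.toLin' (G.adjMatrix ℝ)) μ}
      (graphSpectralRadius G) := by
  have h : (G.adjMatrix ℝ).IsHermitian := by
    rw [Matrix.IsHermitian, Matrix.conjTranspose_eq_transpose_of_trivial]
    exact G.isSymm_adjMatrix
  have hset : {μ : ℝ | Module.End.HasEigenvalue (Matrix.toLin' (G.adjMatrix ℝ)) μ}
      = spectrum ℝ (G.adjMatrix ℝ) := by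
    ext μ
    rw [Set.mem_ofPred_eq, Module.End.hasEigenvalue_iff_mem_spectrum, Matrix.spectrum_toLin']
  rw [hset, graphSpectralRadius, h.spectrum_real_eq_range_eigenvalues]
  have hf : (Set.range h.eigenvalues).Finite := Set.finite_range _
  exact ⟨(Set.range_nonempty _).csSup_mem hf, fun x hx => le_csSup hf.bddAbove hx⟩

/-- The graph `K_2 ∨ ((k+1) K_1 ∪ K_{n-k-3})`. The disjoint union of `k + 1` copies of `K_1` is
the edgeless graph on `k + 1` vertices. It has order `n` when `k + 3 ≤ n`. -/
def extremalGraph (n k : ℕ) : SimpleGraph (Fin 2 ⊕ (Fin (k + 1) ⊕ Fin (n - k - 3))) :=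
  graphJoin (⊤ : SimpleGraph (Fin 2))
    (SimpleGraph.sum (⊥ : SimpleGraph (Fin (k + 1))) (⊤ : SimpleGraph (Fin (n - k - 3))))

/-!
Let `uv` be an edge of `G` and suppose that no matching with `(n - k) / 2` edges contains it, so
that `G - u - v` has no matching missing at most `k` vertices. Joining `G - u - v` to a clique on
`k` new vertices and applying Tutte's theorem (`exists_matching_or_separation`) gives a vertex set
`S ⊇ {u, v}`, of order `s`, whose deletion leaves at least `s + k` components: Tutte's theorem
supplies one component too many, and parity a second one, which accounts for `u` and `v`. Thus `G`
is a subgraph of a `separationGraph`: the join of a clique on `S` with a disjoint union of exactly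
`s + k` cliques, of orders `a i`.

Let `μ` be the root above `n - k - 2` of the characteristic equation of the quotient matrix of
`K_2 ∨ ((k+1) K_1 ∪ K_{n-k-3})`. It is an eigenvalue of that graph, so `μ ≤ ρ(G)`. On the separation
graph consider the positive vector equal to `1` on `S` and to `s / (μ + 1 - a i)` on the `i`-th
clique. It satisfies `A x = μ x` outside `S`, while on `S` the entry of `A x` is
`(s - 1) + s ∑ a i / (μ + 1 - a i)`. By convexity this is largest when all but one of the `a i` are
equal to `1` (`sum_div_le_of_sum_eq`); the largest value is equal to `μ` for `s = 2`, by the choice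
of `μ`, and less than `μ` for `s ≥ 3`, by the hypothesis `n ≥ 5 k + 6` (`bound_lt_of_three_le`).
Hence `A x ≤ μ x`. Pairing `x` with the absolute value of an eigenvector for `ρ(G) ≥ μ` shows that
`G` is the whole separation graph and that `A x = μ x`
(`eq_and_sum_adj_eq_of_le_graphSpectralRadius`). So `s = 2`, some clique has the largest possible
order, the others are single vertices, and `G` is the extremal graph.
-/

/-! ### Matchings, and a deficiency form of Tutte's theorem -/

/-- A set of pairwise disjoint edges is the edge set of a matching. -/
theorem exists_isMatching_edgeSet_eq {V : Type*} {G : SimpleGraph V} {E : Set (Sym2 V)}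
    (hE : E ⊆ G.edgeSet) (hdisj : ∀ x y z, s(x, y) ∈ E → s(x, z) ∈ E → y = z) :
    ∃ M : G.Subgraph, M.IsMatching ∧ M.edgeSet = E := by
  refine ⟨{ verts := {x | ∃ y, s(x, y) ∈ E}
            Adj := fun x y => s(x, y) ∈ E
            adj_sub := fun h => hE h
            edge_vert := fun {v w} h => ⟨w, h⟩
            symm := ⟨fun x y h => by rwa [Sym2.eq_swap]⟩ }, ?_, ?_⟩
  · rintro v ⟨w, hw⟩
    exact ⟨w, hw, fun z hz => hdisj v z w hz hw⟩
  · ext e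
    induction e with
    | _ x y => exact Iff.rfl

theorem SimpleGraph.Subgraph.IsPerfectMatching.two_mul_ncard_edgeSet {V : Type*} [Fintype V]
    {G : SimpleGraph V} {M : G.Subgraph} (hM : M.IsPerfectMatching) :
    2 * M.edgeSet.ncard = Fintype.card V := by
  classical
  have h := M.spanningCoe.sum_degrees_eq_twice_card_edges
  have hdeg : ∀ v, M.spanningCoe.degree v = 1 := fun v => by
    rw [SimpleGraph.Subgraph.degree_spanningCoe]
    exact SimpleGraph.Subgraph.isPerfectMatching_iff_forall_degree.1 hM v
  simp only [hdeg, Finset.sum_const, Finset.card_univ, smul_eq_mul, mul_one] at h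
  rw [h, ← SimpleGraph.Subgraph.edgeSet_spanningCoe, Set.ncard_eq_toFinset_card']
  rfl

/-- Deficiency form of Tutte's theorem: if the order of `H` has the parity of `k`, then either `H`
has a matching missing at most `k` vertices, or some set `T` leaves at least `|T| + k + 2`
components when deleted. The components are recorded, after merging any surplus ones, by a
colouring of the remaining vertices which is constant along edges and uses all `|T| + k + 2`
colours. -/
theorem exists_matching_or_separation {W : Type*} [Fintype W] (H : SimpleGraph W) (k : ℕ)
    (hpar : Fintype.card W % 2 = k % 2) :
    (∃ E : Set (Sym2 W), E ⊆ H.edgeSet ∧ (∀ x y z, s(x, y) ∈ E → s(x, z) ∈ E → y = z) ∧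
      Fintype.card W ≤ 2 * E.ncard + k) ∨
    (∃ T : Finset W, ∃ c : W → Fin (T.card + k + 2),
      (∀ i, ∃ x, x ∉ T ∧ c x = i) ∧ ∀ x y, x ∉ T → y ∉ T → H.Adj x y → c x = c y) := by
  classical
  -- Tutte's theorem is applied to the join of `H` with a clique on `k` new vertices.
  set J : SimpleGraph (W ⊕ Fin k) := graphJoin H ⊤ with hJ
  have hJll : ∀ x y, J.Adj (.inl x) (.inl y) ↔ H.Adj x y := by
    intro x y; simp [hJ, graphJoin]
  have hJr : ∀ x i, x ≠ .inr i → J.Adj x (.inr i) := by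
    rintro (x | j) i h <;> simp_all [graphJoin]
  have hcard : Fintype.card (W ⊕ Fin k) = Fintype.card W + k := by simp
  by_cases hpm : ∃ M : J.Subgraph, M.IsPerfectMatching
  · left
    obtain ⟨M, hM⟩ := hpm
    have hinj : Function.Injective (Sym2.map (Sum.inl : W → W ⊕ Fin k)) :=
      Sym2.map.injective Sum.inl_injective
    refine ⟨Sym2.map Sum.inl ⁻¹' M.edgeSet, ?_, ?_, ?_⟩
    · intro e
      induction e with
      | _ x y => exact fun h => (hJll x y).1 (M.adj_sub h)
    · intro x y z hy hz
      exact Sum.inl_injective (hM.1.eq_of_adj_left (u := Sum.inl x) hy hz)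
    · have hp := hM.two_mul_ncard_edgeSet
      choose p hp1 hp2 using SimpleGraph.Subgraph.isPerfectMatching_iff.1 hM
      have hsub : M.edgeSet ⊆ Sym2.map Sum.inl '' (Sym2.map Sum.inl ⁻¹' M.edgeSet) ∪
          Set.range (fun i : Fin k => s(Sum.inr i, p (Sum.inr i))) := by
        intro e
        induction e with
        | _ x y =>
          intro h
          rcases x with x | i
          · rcases y with y | i
            · exact Or.inl ⟨s(x, y), h, rfl⟩
            · refine Or.inr ⟨i, ?_⟩
              have h' : M.Adj (.inr i) (.inl x) := M.adj_symm h
              change s(_, _) = _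
              rw [← hp2 _ _ h', Sym2.eq_swap]
          · refine Or.inr ⟨i, ?_⟩
            change s(_, _) = _
            rw [← hp2 _ _ h]
      have h1 := (Set.ncard_le_ncard hsub).trans (Set.ncard_union_le _ _)
      have h2 : (Set.range (fun i : Fin k => s(Sum.inr i, p (Sum.inr i)))).ncard ≤ k := by
        rw [← Set.image_univ]
        refine (Set.ncard_image_le).trans ?_
        simp [Set.ncard_univ]
      rw [Set.ncard_image_of_injective _ hinj] at h1
      omega
  · right
    rw [SimpleGraph.tutte] at hpm
    push Not at hpm
    obtain ⟨U, hU⟩ := hpm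
    rw [SimpleGraph.IsTutteViolator] at hU
    set K := ((⊤ : J.Subgraph).deleteVerts U).coe with hK
    have hverts : ((⊤ : J.Subgraph).deleteVerts U).verts = Uᶜ := by
      ext x; simp
    have hUcard : U.ncard + Nat.card ((⊤ : J.Subgraph).deleteVerts U).verts
        = Fintype.card W + k := by
      rw [hverts, Nat.card_coe_set_eq, Set.ncard_add_ncard_compl, Nat.card_eq_fintype_card, hcard]
    have hodd := K.odd_ncard_oddComponents
    have hge : U.ncard + 2 ≤ K.oddComponents.ncard := by
      simp only [Nat.odd_iff] at hodd
      omega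
    have hcomp : U.ncard + 2 ≤ Nat.card K.ConnectedComponent := by
      refine hge.trans ?_
      rw [← Set.ncard_univ]
      exact Set.ncard_le_ncard (Set.subset_univ _)
    -- A new vertex outside `U` would be adjacent to everything else, leaving a single component.
    have hnew : ∀ i : Fin k, Sum.inr i ∈ U := by
      intro i
      by_contra hi
      have hiK : Sum.inr i ∈ ((⊤ : J.Subgraph).deleteVerts U).verts := by rw [hverts]; exact hi
      have hall : ∀ C : K.ConnectedComponent, C = K.connectedComponentMk ⟨_, hiK⟩ := by
        intro C
        induction C using SimpleGraph.ConnectedComponent.ind with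
        | _ x =>
          rw [SimpleGraph.ConnectedComponent.eq]
          by_cases hx : x = ⟨_, hiK⟩
          · rw [hx]
          · refine SimpleGraph.Adj.reachable ?_
            have hx2 : x.1 ∈ Uᶜ := hverts.subset x.2
            have : J.Adj x.1 (.inr i) := hJr _ _ fun h => hx (Subtype.ext h)
            simpa [hK, hi, this] using hx2
      have : Subsingleton K.ConnectedComponent := ⟨fun a b => (hall a).trans (hall b).symm⟩
      have := Finite.card_le_one_iff_subsingleton (α := K.ConnectedComponent) |>.2 this
      omega
    set T : Finset W := Finset.univ.filter fun x => Sum.inl x ∈ U with hT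
    have hTcard : T.card + k = U.ncard := by
      have : U = ((T.disjSum Finset.univ : Finset (W ⊕ Fin k)) : Set (W ⊕ Fin k)) := by
        ext (x | i) <;> simp [hT, hnew]
      rw [this, Set.ncard_coe_finset, Finset.card_disjSum]
      simp
    have : Nonempty K.ConnectedComponent := by
      apply (Nat.card_pos_iff.1 _).1
      omega
    have hfin : Fintype K.ConnectedComponent := Fintype.ofFinite _
    obtain ⟨f⟩ : Nonempty (Fin (T.card + k + 2) ↪ K.ConnectedComponent) := by
      apply Function.Embedding.nonempty_of_card_le
      rw [Fintype.card_fin, ← Nat.card_eq_fintype_card]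
      omega
    have hg := Function.invFun_surjective f.injective
    set g := Function.invFun f
    have hmem : ∀ x : W, x ∉ T → Sum.inl x ∈ ((⊤ : J.Subgraph).deleteVerts U).verts := by
      intro x hx
      rw [hverts]
      simpa [hT] using hx
    refine ⟨T, fun x => if h : x ∉ T then g (K.connectedComponentMk ⟨_, hmem x h⟩) else 0, ?_, ?_⟩
    · intro i
      obtain ⟨C, rfl⟩ := hg i
      induction C using SimpleGraph.ConnectedComponent.ind with
      | _ x =>
        obtain ⟨x | j, hx⟩ := x
        · have hxT : x ∉ T := by
            rw [hverts] at hx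
            simpa [hT] using hx
          exact ⟨x, hxT, by simp [hxT]⟩
        · rw [hverts] at hx
          exact absurd (hnew j) hx
    · intro x y hx hy hxy
      simp only [hx, hy, not_false_eq_true, dif_pos]
      congr 1
      rw [SimpleGraph.ConnectedComponent.eq]
      refine SimpleGraph.Adj.reachable ?_
      have hx' := hmem x hx
      have hy' := hmem y hy
      rw [hverts] at hx' hy'
      have : J.Adj (.inl x) (.inl y) := (hJll x y).2 hxy
      simpa [hK, this] using And.intro hx' hy'

/-- If the edge `uv` lies in no matching of size `(n - k) / 2`, then some vertex set `S`
containing `u` and `v` leaves at least `|S| + k` components when deleted. -/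
theorem exists_matching_through_edge_or_separation {V : Type*} [Fintype V] (G : SimpleGraph V)
    (k : ℕ) (hk : k + 2 ≤ Fintype.card V) (hpar : Fintype.card V % 2 = k % 2) {u v : V}
    (huv : G.Adj u v) :
    (∃ M : G.Subgraph, M.IsMatching ∧ M.edgeSet.ncard = (Fintype.card V - k) / 2 ∧
      s(u, v) ∈ M.edgeSet) ∨
    (∃ S : Finset V, 2 ≤ S.card ∧ ∃ c : V → Fin (S.card + k),
      (∀ i, ∃ x, x ∉ S ∧ c x = i) ∧ ∀ x y, x ∉ S → y ∉ S → G.Adj x y → c x = c y) := by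
  classical
  have hne := huv.ne
  have hcard : Fintype.card {x // x ∉ ({u, v} : Finset V)} = Fintype.card V - 2 := by
    rw [Fintype.card_subtype_compl, Fintype.card_coe, Finset.card_pair hne]
  rcases exists_matching_or_separation (G.comap (Subtype.val : {x // x ∉ ({u, v} : Finset V)} → V))
    k (by omega) with ⟨E, hEG, hE, hEcard⟩ | ⟨T, c, hc, hcadj⟩
  · left
    set F : Set (Sym2 V) := insert s(u, v) (Sym2.map Subtype.val '' E) with hF
    have himg : ∀ x y, s(x, y) ∈ Sym2.map Subtype.val '' E →
        ∃ (hx : x ∉ ({u, v} : Finset V)) (hy : y ∉ ({u, v} : Finset V)),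
          s(⟨x, hx⟩, ⟨y, hy⟩) ∈ E := by
      rintro x y ⟨e, he, h⟩
      induction e with
      | _ a b =>
        rw [Sym2.map_mk] at h
        rcases Sym2.eq_iff.1 h with ⟨rfl, rfl⟩ | ⟨rfl, rfl⟩
        · exact ⟨a.2, b.2, he⟩
        · exact ⟨b.2, a.2, by rwa [Sym2.eq_swap]⟩
    have hnot : s(u, v) ∉ Sym2.map Subtype.val '' E := by
      intro h
      obtain ⟨hx, -⟩ := himg _ _ h
      simp at hx
    have hFcard : F.ncard = E.ncard + 1 := by
      rw [hF, Set.ncard_insert_of_notMem hnot,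
        Set.ncard_image_of_injective _ (Sym2.map.injective Subtype.val_injective)]
    have hFG : F ⊆ G.edgeSet := by
      rintro e (rfl | ⟨e, he, rfl⟩)
      · exact huv
      · have := hEG he
        induction e with
        | _ a b => exact this
    have hFdisj : ∀ x y z, s(x, y) ∈ F → s(x, z) ∈ F → y = z := by
      rintro x y z (h1 | h1) (h2 | h2)
      · have := h1.trans h2.symm
        rw [Sym2.eq_iff] at this
        rcases this with ⟨-, h⟩ | ⟨h, h'⟩
        exacts [h, h'.trans h]
      · obtain ⟨hx, -⟩ := himg _ _ h2
        rcases Sym2.eq_iff.1 h1 with ⟨rfl, rfl⟩ | ⟨rfl, rfl⟩ <;> simp at hx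
      · obtain ⟨hx, -⟩ := himg _ _ h1
        rcases Sym2.eq_iff.1 h2 with ⟨rfl, rfl⟩ | ⟨rfl, rfl⟩ <;> simp at hx
      · obtain ⟨hx, hy, h1⟩ := himg _ _ h1
        obtain ⟨_, hz, h2⟩ := himg _ _ h2
        exact congrArg Subtype.val (hE _ _ _ h1 h2)
    obtain ⟨F', hF1, hF2, hF3⟩ := Set.exists_subsuperset_card_eq
      (s := {s(u, v)}) (t := F) (n := (Fintype.card V - k) / 2) (by simp [hF])
      (by rw [Set.ncard_singleton]; omega) (by omega)
    obtain ⟨M, hM, hME⟩ := exists_isMatching_edgeSet_eq (hF2.trans hFG)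
      fun x y z h1 h2 => hFdisj x y z (hF2 h1) (hF2 h2)
    exact ⟨M, hM, by rw [hME, hF3], by rw [hME]; exact hF1 rfl⟩
  · right
    set S : Finset V := {u, v} ∪ T.map (Function.Embedding.subtype _) with hS
    have hScard : S.card = T.card + 2 := by
      rw [hS, Finset.card_union_of_disjoint, Finset.card_pair hne, Finset.card_map, add_comm]
      rw [Finset.disjoint_left]
      intro x hx hx'
      obtain ⟨y, -, rfl⟩ := Finset.mem_map.1 hx'
      exact y.2 hx
    have hSn : ∀ x, x ∉ S → ∃ h : x ∉ ({u, v} : Finset V), (⟨x, h⟩ : {x // x ∉ _}) ∉ T := by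
      intro x hx
      rw [hS, Finset.mem_union, not_or] at hx
      exact ⟨hx.1, fun h => hx.2 (Finset.mem_map.2 ⟨_, h, rfl⟩)⟩
    have heq : T.card + k + 2 = S.card + k := by omega
    refine ⟨S, by omega, fun x => Fin.cast heq
      (if h : x ∉ ({u, v} : Finset V) then c ⟨x, h⟩ else 0), ?_, ?_⟩
    · intro i
      obtain ⟨x, hxT, hx⟩ := hc (Fin.cast heq.symm i)
      refine ⟨x.1, ?_, ?_⟩
      · rw [hS, Finset.mem_union, not_or]
        refine ⟨x.2, fun h => hxT ?_⟩
        obtain ⟨y, hy, hyx⟩ := Finset.mem_map.1 h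
        rwa [← Subtype.ext (a1 := y) (a2 := x) hyx]
      · simp only [dif_pos x.2]
        simp [hx]
    · intro x y hx hy hxy
      obtain ⟨hx1, hx2⟩ := hSn x hx
      obtain ⟨hy1, hy2⟩ := hSn y hy
      simp only [dif_pos hx1, dif_pos hy1, hcadj ⟨x, hx1⟩ ⟨y, hy1⟩ hx2 hy2 hxy]

/-! ### Comparison of spectral radii through a positive supersolution -/

open Classical in
/-- Let `G` be a subgraph of a connected graph `H`, and let `x` be a positive vector with
`A(H) x ≤ μ x`. Then `ρ(G) ≤ μ`; this is the rigid case: if `μ ≤ ρ(G)`, then `G = H` and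
`A(H) x = μ x`. -/
theorem eq_and_sum_adj_eq_of_le_graphSpectralRadius {V : Type*} [Fintype V] [Nonempty V]
    {G H : SimpleGraph V} (hGH : G ≤ H) (hH : H.Connected) {x : V → ℝ} (hx : ∀ v, 0 < x v)
    {μ : ℝ} (hμ : ∀ v, (∑ w, if H.Adj v w then x w else 0) ≤ μ * x v)
    (hρ : μ ≤ graphSpectralRadius G) :
    G = H ∧ ∀ v, (∑ w, if H.Adj v w then x w else 0) = μ * x v := by
  obtain ⟨z, hz⟩ := (isGreatest_graphSpectralRadius G).1.exists_hasEigenvector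
  have hz0 : z ≠ 0 := hz.2
  have hzeq := hz.apply_eq_smul
  -- The entrywise absolute value `y` of an eigenvector for `ρ(G)` satisfies `μ y ≤ A(G) y`.
  obtain ⟨y, hy⟩ : ∃ y : V → ℝ, ∀ v, y v = |z v| := ⟨_, fun _ => rfl⟩
  have hy0 : ∀ v, 0 ≤ y v := fun v => by rw [hy]; exact abs_nonneg _
  have hG : ∀ v, μ * y v ≤ ∑ w, if G.Adj v w then y w else 0 := by
    intro v
    have h1 : ∑ w, (if G.Adj v w then z w else 0) = graphSpectralRadius G * z v := by
      have := congrFun hzeq v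
      simpa [Matrix.mulVec, dotProduct, SimpleGraph.adjMatrix_apply, ite_mul] using this
    calc μ * y v ≤ graphSpectralRadius G * y v := mul_le_mul_of_nonneg_right hρ (hy0 v)
      _ ≤ |graphSpectralRadius G * z v| := by
        rw [abs_mul, hy]; exact mul_le_mul_of_nonneg_right (le_abs_self _) (abs_nonneg _)
      _ = |∑ w, (if G.Adj v w then z w else 0)| := by rw [h1]
      _ ≤ ∑ w, |if G.Adj v w then z w else 0| := Finset.abs_sum_le_sum_abs _ _
      _ = ∑ w, if G.Adj v w then y w else 0 := by
        refine Finset.sum_congr rfl fun w _ => ?_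
        split_ifs <;> simp [hy]
  have hterm : ∀ v w, (if G.Adj v w then y w else 0) ≤ if H.Adj v w then y w else 0 := by
    intro v w
    by_cases h : G.Adj v w
    · simp [h, hGH h]
    · rw [if_neg h]
      split_ifs <;> simp [hy0]
  have hGHsum : ∀ v, (∑ w, if G.Adj v w then y w else 0) ≤ ∑ w, if H.Adj v w then y w else 0 :=
    fun v => Finset.sum_le_sum fun w _ => hterm v w
  have hswap : ∑ v, x v * (∑ w, if H.Adj v w then y w else 0)
      = ∑ v, y v * ∑ w, if H.Adj v w then x w else 0 := by
    simp only [Finset.mul_sum]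
    rw [Finset.sum_comm]
    refine Finset.sum_congr rfl fun v _ => Finset.sum_congr rfl fun w _ => ?_
    simp only [H.adj_comm w v]
    split_ifs <;> ring
  have hA : ∀ v ∈ Finset.univ, 0 ≤ x v * ((∑ w, if H.Adj v w then y w else 0) - μ * y v) :=
    fun v _ => mul_nonneg (hx v).le (sub_nonneg.2 ((hG v).trans (hGHsum v)))
  have hB : ∀ v ∈ Finset.univ, 0 ≤ y v * (μ * x v - ∑ w, if H.Adj v w then x w else 0) :=
    fun v _ => mul_nonneg (hy0 v) (sub_nonneg.2 (hμ v))
  -- By symmetry of `A(H)` the two nonnegative defects are opposite, so both vanish.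
  have hAB : ∑ v, x v * ((∑ w, if H.Adj v w then y w else 0) - μ * y v)
      = - ∑ v, y v * (μ * x v - ∑ w, if H.Adj v w then x w else 0) := by
    simp only [mul_sub, Finset.sum_sub_distrib, hswap, neg_sub]
    congr 1
    exact Finset.sum_congr rfl fun v _ => by ring
  have hA0 := (Finset.sum_eq_zero_iff_of_nonneg hA).1
    (le_antisymm (by linarith [Finset.sum_nonneg hB]) (Finset.sum_nonneg hA))
  have hB0 := (Finset.sum_eq_zero_iff_of_nonneg hB).1
    (le_antisymm (by linarith [Finset.sum_nonneg hA]) (Finset.sum_nonneg hB))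
  have hyeq : ∀ v, (∑ w, if H.Adj v w then y w else 0) = μ * y v := fun v =>
    sub_eq_zero.1 ((mul_eq_zero.1 (hA0 v (Finset.mem_univ v))).resolve_left (hx v).ne')
  have hypos : ∀ v, 0 < y v := by
    by_contra! hcon
    obtain ⟨v, hv⟩ := hcon
    have hv0 : y v = 0 := le_antisymm hv (hy0 v)
    have hstep : ∀ a b, H.Adj a b → y a = 0 → y b = 0 := by
      intro a b hab ha
      have h0 := hyeq a
      rw [ha, mul_zero] at h0
      have := (Finset.sum_eq_zero_iff_of_nonneg
        (fun w _ => by split_ifs <;> simp [hy0])).1 h0 b (Finset.mem_univ b)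
      simpa [hab] using this
    have hwalk : ∀ a b, H.Walk a b → y a = 0 → y b = 0 := by
      intro a b p
      induction p with
      | nil => exact id
      | cons h _ ih => exact fun ha => ih (hstep _ _ h ha)
    apply hz0
    ext w
    obtain ⟨p⟩ := hH.preconnected v w
    have := hwalk v w p hv0
    rw [hy] at this
    simpa using this
  refine ⟨le_antisymm hGH fun v w hvw => ?_, fun v => ?_⟩
  · have h1 : ∀ w ∈ Finset.univ, (if G.Adj v w then y w else 0) = if H.Adj v w then y w else 0 :=
      (Finset.sum_eq_sum_iff_of_le fun w _ => hterm v w).1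
        (le_antisymm (hGHsum v) ((hyeq v).trans_le (hG v)))
    have h2 := h1 w (Finset.mem_univ w)
    by_contra hcon
    rw [if_neg hcon, if_pos hvw] at h2
    exact (hypos w).ne h2
  · exact (sub_eq_zero.1 ((mul_eq_zero.1 (hB0 v (Finset.mem_univ v))).resolve_left
      (hypos v).ne')).symm

/-! ### A lower bound for the spectral radius of the extremal graph -/

theorem extremalGraph_adj_inl_inl {n k : ℕ} (i j : Fin 2) :
    (extremalGraph n k).Adj (.inl i) (.inl j) ↔ i ≠ j := by
  simp [extremalGraph, graphJoin]

theorem extremalGraph_adj_inl_inr {n k : ℕ} (i : Fin 2) (x : Fin (k + 1) ⊕ Fin (n - k - 3)) :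
    (extremalGraph n k).Adj (.inl i) (.inr x) ↔ True := by
  simp [extremalGraph, graphJoin]

theorem extremalGraph_adj_inr_inl {n k : ℕ} (i : Fin 2) (x : Fin (k + 1) ⊕ Fin (n - k - 3)) :
    (extremalGraph n k).Adj (.inr x) (.inl i) ↔ True := by
  simp [extremalGraph, graphJoin]

theorem extremalGraph_adj_inr_inl_inr {n k : ℕ} (i : Fin (k + 1))
    (x : Fin (k + 1) ⊕ Fin (n - k - 3)) :
    (extremalGraph n k).Adj (.inr (.inl i)) (.inr x) ↔ False := by
  rcases x with x | x <;> simp [extremalGraph, graphJoin]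

theorem extremalGraph_adj_inr_inr_inl {n k : ℕ} (i : Fin (n - k - 3)) (j : Fin (k + 1)) :
    (extremalGraph n k).Adj (.inr (.inr i)) (.inr (.inl j)) ↔ False := by
  simp [extremalGraph, graphJoin]

theorem extremalGraph_adj_inr_inr_inr {n k : ℕ} (i j : Fin (n - k - 3)) :
    (extremalGraph n k).Adj (.inr (.inr i)) (.inr (.inr j)) ↔ i ≠ j := by
  simp [extremalGraph, graphJoin]

theorem sum_ite_ne {ι : Type*} [Fintype ι] (i : ι) [DecidablePred (i ≠ ·)] (b : ℝ) :
    (∑ j, if i ≠ j then b else 0) = (Fintype.card ι - 1) * b := by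
  classical
  have h : ∀ j, (if i ≠ j then b else 0) = b - if i = j then b else 0 := by
    intro j; split_ifs <;> simp_all
  rw [Finset.sum_congr rfl fun j _ => h j, Finset.sum_sub_distrib]
  simp only [Finset.sum_const, Finset.card_univ, nsmul_eq_mul, Finset.sum_ite_eq, Finset.mem_univ,
    if_true]
  ring

/-- The displayed equation is the characteristic equation of the quotient matrix of the extremal
graph, with `N = n - k - 3`; its roots are eigenvalues. -/
theorem le_graphSpectralRadius_extremalGraph {n k : ℕ} {μ : ℝ} (h0 : 0 < μ)
    (hN : 0 < μ + 1 - ((n - k - 3 : ℕ) : ℝ))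
    (hμ : μ - 1 = 2 * (k + 1) / μ + 2 * ((n - k - 3 : ℕ) : ℝ) / (μ + 1 - ((n - k - 3 : ℕ) : ℝ))) :
    μ ≤ graphSpectralRadius (extremalGraph n k) := by
  classical
  apply (isGreatest_graphSpectralRadius (extremalGraph n k)).2
  refine Module.End.hasEigenvalue_of_hasEigenvector
    (x := Sum.elim (fun _ => 1)
      (Sum.elim (fun _ => 2 / μ) fun _ => 2 / (μ + 1 - ((n - k - 3 : ℕ) : ℝ)))) ?_
  rw [Module.End.hasEigenvector_iff, Module.End.mem_eigenspace_iff]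
  refine ⟨?_, fun h => by simpa using congrFun h (Sum.inl 0)⟩
  have hbeta := hN.ne'
  have hmu := h0.ne'
  change Matrix.mulVec ((extremalGraph n k).adjMatrix ℝ) _ = _
  ext (i | i | i)
  · simp only [Matrix.mulVec, dotProduct, SimpleGraph.adjMatrix_apply, Fintype.sum_sum_type,
      extremalGraph_adj_inl_inl, extremalGraph_adj_inl_inr, Sum.elim_inl, Sum.elim_inr, if_true,
      ite_mul, one_mul, zero_mul, sum_ite_ne, Finset.sum_const, Finset.card_univ, Fintype.card_fin,
      nsmul_eq_mul, Pi.smul_apply, smul_eq_mul]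
    push_cast
    linear_combination -hμ
  · simp only [Matrix.mulVec, dotProduct, SimpleGraph.adjMatrix_apply, Fintype.sum_sum_type,
      extremalGraph_adj_inr_inl, extremalGraph_adj_inr_inl_inr, Sum.elim_inl, Sum.elim_inr, if_true,
      if_false, ite_mul, one_mul, zero_mul, Finset.sum_const, Finset.card_univ, Fintype.card_fin,
      nsmul_eq_mul, Pi.smul_apply, smul_eq_mul]
    field_simp
    simp
  · simp only [Matrix.mulVec, dotProduct, SimpleGraph.adjMatrix_apply, Fintype.sum_sum_type,
      extremalGraph_adj_inr_inl, extremalGraph_adj_inr_inr_inl, extremalGraph_adj_inr_inr_inr,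
      Sum.elim_inl, Sum.elim_inr, if_true, sum_ite_ne,
      if_false, ite_mul, one_mul, zero_mul, Finset.sum_const, Finset.card_univ, Fintype.card_fin,
      nsmul_eq_mul, Pi.smul_apply, smul_eq_mul]
    field_simp
    push_cast
    ring

theorem exists_root_quotient_equation (N k : ℕ) :
    ∃ μ : ℝ, (N : ℝ) + 1 < μ ∧ μ - 1 = 2 * (k + 1) / μ + 2 * (N : ℝ) / (μ + 1 - N) := by
  have hk : (0 : ℝ) ≤ k := k.cast_nonneg
  have hN : (0 : ℝ) ≤ N := N.cast_nonneg
  obtain ⟨μ, ⟨h1, h2⟩, h3⟩ := intermediate_value_Icc (a := (N : ℝ) + 1) (b := N + 2 * k + 5)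
    (by linarith)
    (f := fun t : ℝ => (t - 1) * t * (t + 1 - N) - 2 * (k + 1) * (t + 1 - N) - 2 * N * t)
    (by fun_prop) (show (0 : ℝ) ∈ _ from ⟨by ring_nf; nlinarith, by
      ring_nf; positivity⟩)
  simp only at h3
  have hlt : (N : ℝ) + 1 < μ := by
    refine lt_of_le_of_ne h1 fun h => ?_
    rw [← h] at h3
    nlinarith
  refine ⟨μ, hlt, ?_⟩
  have a1 : μ ≠ 0 := by linarith
  have a2 : μ + 1 - N ≠ 0 := by linarith
  field_simp
  linarith

/-! ### Numerical estimates -/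

/-- Among positive integers with prescribed sum, `∑ aᵢ / (μ + 1 - aᵢ)` is largest when all but one
are equal to `1`; the remaining one is then equal to `T`. -/
theorem sum_div_le_of_sum_eq {q T : ℕ} (hq : 0 < q) {a : Fin q → ℕ} (ha : ∀ i, 1 ≤ a i)
    (hsum : ∑ i, a i + 1 = T + q) {μ : ℝ} (h0 : 0 < μ) (hμ : (T : ℝ) < μ + 1) :
    (∀ i, a i ≤ T) ∧
    (∑ i, (a i : ℝ) / (μ + 1 - a i) ≤ (q - 1) / μ + T / (μ + 1 - T)) ∧
    (2 ≤ T → (∑ i, (a i : ℝ) / (μ + 1 - a i) = (q - 1) / μ + T / (μ + 1 - T)) →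
      ∃ i, a i = T) := by
  have hle : ∀ i, a i ≤ T := by
    intro i
    have h1 := Finset.add_sum_erase Finset.univ a (Finset.mem_univ i)
    have h2 : (Finset.univ.erase i).card • 1 ≤ ∑ j ∈ Finset.univ.erase i, a j :=
      Finset.card_nsmul_le_sum _ _ _ fun j _ => ha j
    rw [Finset.card_erase_of_mem (Finset.mem_univ i), Finset.card_univ, Fintype.card_fin] at h2
    simp only [smul_eq_mul, mul_one] at h2
    omega
  have hTpos : 0 < μ + 1 - T := by linarith
  -- The chord of the convex function `t ↦ t / (μ + 1 - t)` over `[1, T]`.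
  set C : ℝ := (μ + 1) / (μ * (μ + 1 - T)) with hC
  have hchord : ∀ i, (1 / μ + ((a i : ℝ) - 1) * C) - (a i : ℝ) / (μ + 1 - a i)
      = (μ + 1) / μ * ((a i - 1) * (T - a i)) / ((μ + 1 - T) * (μ + 1 - a i)) := by
    intro i
    have : (a i : ℝ) ≤ T := by exact_mod_cast hle i
    have h2 : μ + 1 - a i ≠ 0 := by linarith
    have h3 := hTpos.ne'
    rw [hC]
    field_simp
    ring
  have hsumR : ∑ i, (a i : ℝ) + 1 = T + q := by exact_mod_cast hsum
  have htot : ∑ i, (1 / μ + ((a i : ℝ) - 1) * C) = (q - 1) / μ + T / (μ + 1 - T) := by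
    rw [Finset.sum_add_distrib, ← Finset.sum_mul, Finset.sum_sub_distrib]
    simp only [Finset.sum_const, Finset.card_univ, Fintype.card_fin, nsmul_eq_mul, mul_one]
    rw [show ∑ i, (a i : ℝ) - q = T - 1 by linarith, hC]
    have h3 := hTpos.ne'
    field_simp
    ring
  have hterm : ∀ i ∈ Finset.univ, (a i : ℝ) / (μ + 1 - a i) ≤ 1 / μ + ((a i : ℝ) - 1) * C := by
    intro i _
    rw [← sub_nonneg, hchord]
    have h1 : (a i : ℝ) ≤ T := by exact_mod_cast hle i
    have h2 : (1 : ℝ) ≤ a i := by exact_mod_cast ha i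
    have h3 : 0 < μ + 1 - a i := by linarith
    have h4 : (0 : ℝ) ≤ (a i - 1) * (T - a i) := mul_nonneg (by linarith) (by linarith)
    positivity
  refine ⟨hle, htot ▸ Finset.sum_le_sum hterm, fun hT heq => ?_⟩
  rw [← htot, Finset.sum_eq_sum_iff_of_le hterm] at heq
  have hex : ∃ i, a i ≠ 1 := by
    by_contra! hcon
    simp only [hcon, Finset.sum_const, Finset.card_univ, Fintype.card_fin, smul_eq_mul] at hsum
    omega
  obtain ⟨i, hi⟩ := hex
  refine ⟨i, ?_⟩
  have h := hchord i
  rw [heq i (Finset.mem_univ i), sub_self] at h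
  have h1 : (a i : ℝ) ≤ T := by exact_mod_cast hle i
  have h3 : μ + 1 - a i ≠ 0 := by linarith
  have h4 : (a i : ℝ) - 1 ≠ 0 := sub_ne_zero.2 (by exact_mod_cast hi)
  have h5 : (T : ℝ) - a i = 0 := by
    by_contra h5
    have : (μ + 1) / μ * ((a i - 1) * (T - a i)) / ((μ + 1 - T) * (μ + 1 - a i)) ≠ 0 := by
      have : μ + 1 ≠ 0 := by linarith
      have h6 := hTpos.ne'
      positivity
    exact this h.symm
  exact_mod_cast (sub_eq_zero.1 h5).symm

/-- The bound for `s ≥ 3`. Here `m = n - k - 2`, and `T = m + 3 - 2 s` is the order of the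
largest possible component after the deletion of `s` vertices. The estimate is proved with `m` in
place of `μ`, except for `m = 4`, where it fails and the equation for `μ` is needed. -/
theorem bound_lt_of_three_le {k m s T : ℕ} (hm : 4 * k + 4 ≤ m) (hm2 : Even m) (hs : 3 ≤ s)
    (hT : T + 2 * s = m + 3) (hT1 : 1 ≤ T) {μ : ℝ} (hμm : (m : ℝ) < μ)
    (hμ : μ - 1 = 2 * (k + 1) / μ + 2 * ((m : ℝ) - 1) / (μ + 2 - m)) :
    ((s : ℝ) - 1) + s * ((s + k - 1) / μ + T / (μ + 1 - T)) < μ := by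
  by_cases hm4 : m = 4
  · have hk0 : k = 0 := by omega
    have hs3 : s = 3 := by omega
    have hT1 : T = 1 := by omega
    subst hm4 hk0 hs3 hT1
    push_cast at *
    have h1 : μ ≠ 0 := by linarith
    have h2 : μ - 2 ≠ 0 := by linarith
    have h3 : μ + 2 - 4 ≠ 0 := by linarith
    have hp : (μ - 1) * (μ * μ - 2 * μ - 9) = 5 - μ := by
      field_simp at hμ
      nlinarith
    have hq : 0 < μ * μ - 2 * μ - 9 := by
      by_contra hcon
      have : μ < 5 := by nlinarith
      nlinarith
    rw [show (3 : ℝ) - 1 + 3 * ((3 + 0 - 1) / μ + 1 / (μ + 1 - 1)) = 2 + 9 / μ by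
      rw [add_sub_cancel_right]; field_simp; ring]
    rw [← lt_sub_iff_add_lt', div_lt_iff₀ (by linarith)]
    nlinarith
  · have hm6 : 6 ≤ m := by
      obtain ⟨r, hr⟩ := hm2
      omega
    have hmR : (6 : ℝ) ≤ m := by exact_mod_cast hm6
    have hkR : 4 * (k : ℝ) + 4 ≤ m := by exact_mod_cast hm
    have hk0 : (0 : ℝ) ≤ k := k.cast_nonneg
    have hsR : (3 : ℝ) ≤ s := by exact_mod_cast hs
    have hTR : (T : ℝ) + 2 * s = m + 3 := by exact_mod_cast hT
    have hT1R : (1 : ℝ) ≤ T := by exact_mod_cast hT1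
    have e1 : ((s : ℝ) + k - 1) / μ ≤ (s + k - 1) / m :=
      div_le_div_of_nonneg_left (by linarith) (by linarith) hμm.le
    have e2 : (T : ℝ) / (μ + 1 - T) ≤ T / (2 * (s - 1)) :=
      div_le_div_of_nonneg_left (by linarith) (by linarith) (by linarith)
    have e3 : ((s : ℝ) - 1) + s * ((s + k - 1) / m + T / (2 * (s - 1))) ≤ m := by
      obtain ⟨t, ht⟩ : ∃ t : ℝ, t = s - 1 := ⟨_, rfl⟩
      have hs' : (s : ℝ) = t + 1 := by linarith
      have hT' : (T : ℝ) = m + 1 - 2 * t := by linarith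
      have ht2 : 2 ≤ t := by linarith
      have htm : 2 * t ≤ m := by linarith
      rw [hs', hT']
      have hk' : (k : ℝ) ≤ m / 4 - 1 := by linarith
      have e4 : (t + 1 + k - 1) / m ≤ (t + (m / 4 - 1)) / m :=
        div_le_div_of_nonneg_right (by linarith) (by linarith)
      have e5 : t + (t + 1) * ((t + (m / 4 - 1)) / m + (m + 1 - 2 * t) / (2 * t)) ≤ m := by
        have ht0 : t ≠ 0 := by linarith
        have hm0 : (m : ℝ) ≠ 0 := by linarith
        rw [← sub_nonneg]
        have : (m : ℝ) - (t + (t + 1) * ((t + (m / 4 - 1)) / m + (m + 1 - 2 * t) / (2 * t)))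
            = (4 * t * m ^ 2 - (4 * t ^ 2 * m + 4 * t * (t ^ 2 - 1) + t * (t + 1) * m
              + 2 * (t + 1) * m * (m + 1 - 2 * t))) / (4 * t * m) := by
          field_simp
          ring
        rw [this]
        refine div_nonneg ?_ (by positivity)
        -- The numerator is concave in `t`, and nonnegative at `t = 2` and at `t = m / 2`.
        nlinarith [mul_nonneg (sub_nonneg.2 ht2) (sub_nonneg.2 htm),
          mul_nonneg (mul_nonneg (sub_nonneg.2 ht2) (sub_nonneg.2 htm)) (sub_nonneg.2 ht2),
          mul_nonneg (mul_nonneg (sub_nonneg.2 ht2) (sub_nonneg.2 htm)) (sub_nonneg.2 hmR)]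
      have e6 := mul_le_mul_of_nonneg_left e4 (show (0 : ℝ) ≤ t + 1 by linarith)
      have e7 : t + 1 - 1 + (t + 1) * ((t + 1 + k - 1) / m + (m + 1 - 2 * t) / (2 * (t + 1 - 1)))
          = t + (t + 1) * ((t + 1 + k - 1) / m) + (t + 1) * ((m + 1 - 2 * t) / (2 * t)) := by
        ring_nf
      rw [e7]
      linarith
    have e8 := mul_le_mul_of_nonneg_left (add_le_add e1 e2) (show (0 : ℝ) ≤ s by linarith)
    linarith

/-! ### Graphs with many components after the deletion of a vertex set -/

/-- The edge-maximal graph in which the deletion of `S` leaves the colour classes of `c` separated: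
the vertices of `S` are joined to everything, and each colour class outside `S` is a clique. -/
def separationGraph {V : Type*} {q : ℕ} (S : Finset V) (c : V → Fin q) : SimpleGraph V where
  Adj x y := x ≠ y ∧ (x ∈ S ∨ y ∈ S ∨ c x = c y)
  symm := ⟨fun _ _ h => ⟨h.1.symm, by rcases h.2 with h | h | h <;> simp [h]⟩⟩
  loopless := ⟨fun _ h => h.1 rfl⟩

theorem separationGraph_connected {V : Type*} {q : ℕ} {S : Finset V} (hS : S.Nonempty)
    (c : V → Fin q) : (separationGraph S c).Connected := by
  obtain ⟨u, hu⟩ := hS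
  have h : ∀ x, (separationGraph S c).Reachable u x := by
    intro x
    by_cases hx : u = x
    · rw [hx]
    · exact SimpleGraph.Adj.reachable (show _ ∧ _ from ⟨hx, .inl hu⟩)
  exact { preconnected := fun x y => (h x).symm.trans (h y), nonempty := ⟨u⟩ }

open Classical in
/-- The vector equal to `1` on `S` and to `|S| / (μ + 1 - a)` on a colour class of order `a`
satisfies the equation `A x = μ x` for the separation graph outside `S`; on `S` the value of `A x`
does not depend on the vertex. -/
theorem sum_adj_separationGraph {V : Type*} [Fintype V] {q : ℕ} (S : Finset V) (c : V → Fin q)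
    {a : Fin q → ℕ} (ha : ∀ i, a i = (Finset.univ.filter fun x => x ∉ S ∧ c x = i).card)
    {μ : ℝ} (hμ : ∀ i, (a i : ℝ) < μ + 1) {x : V → ℝ}
    (hx : ∀ v, x v = if v ∈ S then 1 else S.card / (μ + 1 - a (c v))) (v : V) :
    (∑ w, if (separationGraph S c).Adj v w then x w else 0) =
      if v ∈ S then (S.card - 1) + S.card * ∑ i, (a i : ℝ) / (μ + 1 - a i) else μ * x v := by
  have hS1 : ∑ w, (if w ∈ S then (1 : ℝ) else 0) = S.card := by simp
  have hcls : ∀ (i : Fin q) (b : ℝ), (∑ w, if w ∉ S ∧ c w = i then b else 0) = a i * b := by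
    intro i b
    rw [← Finset.sum_filter, Finset.sum_const, ← ha, nsmul_eq_mul]
  have hpt : ∑ w, (if w = v then x w else 0) = x v := by simp
  split_ifs with hv
  · have h1 : ∀ w, (if (separationGraph S c).Adj v w then x w else 0) =
        (if w ∈ S then 1 else 0) +
          (∑ i, if w ∉ S ∧ c w = i then (S.card : ℝ) / (μ + 1 - a i) else 0)
          - if w = v then x w else 0 := by
      intro w
      by_cases hw : w = v
      · subst hw
        simp [hx, hv]
      · by_cases hwS : w ∈ S <;> simp [separationGraph, hx, hv, hw, hwS, Ne.symm hw]
    simp only [h1, Finset.sum_sub_distrib, Finset.sum_add_distrib]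
    rw [Finset.sum_comm, hS1, hpt, hx v, if_pos hv, Finset.mul_sum]
    simp only [hcls]
    rw [Finset.sum_congr rfl fun i _ => show (a i : ℝ) * (S.card / (μ + 1 - a i)) =
      S.card * (a i / (μ + 1 - a i)) by ring]
    ring
  · have h1 : ∀ w, (if (separationGraph S c).Adj v w then x w else 0) =
        (if w ∈ S then 1 else 0) +
          (if w ∉ S ∧ c w = c v then (S.card : ℝ) / (μ + 1 - a (c v)) else 0)
          - if w = v then x w else 0 := by
      intro w
      by_cases hw : w = v
      · subst hw
        simp [hx, hv]
      · by_cases hwS : w ∈ S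
        · simp [separationGraph, hx, hw, hwS, Ne.symm hw]
        · by_cases hc : c w = c v
          · simp [separationGraph, hx, hv, hw, hwS, Ne.symm hw, hc]
          · simp [separationGraph, hv, hw, hwS, hc, Ne.symm hc]
    simp only [h1, Finset.sum_sub_distrib, Finset.sum_add_distrib]
    rw [hS1, hpt, hcls, hx v, if_neg hv]
    have := hμ (c v)
    have h2 : μ + 1 - a (c v) ≠ 0 := by linarith
    field_simp
    ring

open Classical in
/-- If `|S| = 2` and the `k + 2` colour classes are nonempty with one of them as large as
possible, then all others are singletons and the separation graph is the extremal graph. -/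
theorem nonempty_iso_extremalGraph {V : Type*} [Fintype V] {q n k : ℕ} (hq : q = k + 2)
    (hn : k + 3 ≤ n) (hcard : Fintype.card V = n) {S : Finset V} (hS : S.card = 2) {c : V → Fin q}
    (hc : ∀ i, ∃ x, x ∉ S ∧ c x = i) {i₀ : Fin q}
    (hi₀ : (Finset.univ.filter fun x => x ∉ S ∧ c x = i₀).card = n - k - 3) :
    Nonempty (SimpleGraph.Iso (separationGraph S c) (extremalGraph n k)) := by
  set B := Finset.univ.filter fun x => x ∉ S ∧ c x = i₀ with hB
  set R := Finset.univ.filter fun x => x ∉ S ∧ c x ≠ i₀ with hR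
  have hSc : (Finset.univ.filter fun x => x ∉ S).card = n - 2 := by
    have := Finset.card_compl S
    rw [hS, hcard] at this
    rw [← this]
    congr 1
    ext; simp
  have hRcard : R.card = k + 1 := by
    have h := Finset.card_filter_add_card_filter_not (s := Finset.univ.filter fun x => x ∉ S)
      (fun x => c x = i₀)
    rw [Finset.filter_filter, Finset.filter_filter, hSc, ← hB] at h
    change B.card + R.card = _ at h
    omega
  have hRinj : Set.InjOn c R := by
    apply Finset.injOn_of_surjOn_of_card_le c (t := Finset.univ.erase i₀)
    · intro x hx
      simp only [hR, Finset.coe_filter, Finset.mem_univ, true_and, Set.mem_ofPred_eq] at hx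
      simp [hx.2]
    · intro i hi
      obtain ⟨x, hx, rfl⟩ := hc i
      refine ⟨x, ?_, rfl⟩
      simp only [Finset.coe_erase, Finset.coe_univ, Set.mem_sdiff, Set.mem_singleton_iff] at hi
      simp [hR, hx, hi.2]
    · rw [hRcard, Finset.card_erase_of_mem (Finset.mem_univ _), Finset.card_univ, Fintype.card_fin]
      omega
  let eS : Fin 2 ≃ S := (S.equivFinOfCardEq hS).symm
  let eR : Fin (k + 1) ≃ R := (R.equivFinOfCardEq hRcard).symm
  let eB : Fin (n - k - 3) ≃ B := (B.equivFinOfCardEq hi₀).symm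
  have pS : ∀ i, (eS i : V) ∈ S := fun i => (eS i).2
  have pR : ∀ i, (eR i : V) ∉ S ∧ c (eR i) ≠ i₀ := fun i => (Finset.mem_filter.1 (eR i).2).2
  have pB : ∀ i, (eB i : V) ∉ S ∧ c (eB i) = i₀ := fun i => (Finset.mem_filter.1 (eB i).2).2
  have iS : ∀ i j, (eS i : V) = eS j ↔ i = j := fun i j => by
    rw [Subtype.coe_inj, eS.injective.eq_iff]
  have iR : ∀ i j, (eR i : V) = eR j ↔ i = j := fun i j => by
    rw [Subtype.coe_inj, eR.injective.eq_iff]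
  have iB : ∀ i j, (eB i : V) = eB j ↔ i = j := fun i j => by
    rw [Subtype.coe_inj, eB.injective.eq_iff]
  have cR : ∀ i j, c (eR i) = c (eR j) ↔ i = j := fun i j => by
    rw [← iR]
    exact hRinj.eq_iff (eR i).2 (eR j).2
  have nSR : ∀ i j, (eS i : V) ≠ eR j := fun i j h => (pR j).1 (h ▸ pS i)
  have nSB : ∀ i j, (eS i : V) ≠ eB j := fun i j h => (pB j).1 (h ▸ pS i)
  have nRB : ∀ i j, (eR i : V) ≠ eB j := fun i j h => (pR i).2 (h ▸ (pB j).2)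
  let f : Fin 2 ⊕ (Fin (k + 1) ⊕ Fin (n - k - 3)) → V :=
    Sum.elim (fun i => eS i) (Sum.elim (fun i => eR i) fun i => eB i)
  have hf : Function.Injective f := by
    rintro (i | i | i) (j | j | j) h <;> simp only [f, Sum.elim_inl, Sum.elim_inr] at h
    · rw [(iS i j).1 h]
    · exact absurd h (nSR i j)
    · exact absurd h (nSB i j)
    · exact absurd h.symm (nSR j i)
    · rw [(iR i j).1 h]
    · exact absurd h (nRB i j)
    · exact absurd h.symm (nSB j i)
    · exact absurd h.symm (nRB j i)
    · rw [(iB i j).1 h]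
  have hfb : Function.Bijective f := by
    rw [Fintype.bijective_iff_injective_and_card]
    refine ⟨hf, ?_⟩
    simp only [Fintype.card_sum, Fintype.card_fin, hcard]
    omega
  refine ⟨SimpleGraph.Iso.symm ⟨Equiv.ofBijective f hfb, ?_⟩⟩
  intro x y
  change (f x ≠ f y ∧ (f x ∈ S ∨ f y ∈ S ∨ c (f x) = c (f y))) ↔ _
  rw [hf.ne_iff]
  rcases x with i | i | i <;> rcases y with j | j | j <;>
    simp [f, extremalGraph, graphJoin, pS, pR, pB, cR, (pR _).2.symm]

/-- If deleting `S`, with `|S| ≥ 2`, leaves at least `|S| + k` components, then `ρ(G)` is at most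
the spectral radius of the extremal graph, with equality only for that graph. -/
theorem nonempty_iso_of_separation {V : Type*} [Fintype V] (G : SimpleGraph V) (n k : ℕ)
    (hcard : Fintype.card V = n) (hn : 5 * k + 6 ≤ n) (hpar : n ≡ k [MOD 2])
    (hρ : graphSpectralRadius (extremalGraph n k) ≤ graphSpectralRadius G)
    {S : Finset V} (hS : 2 ≤ S.card) {c : V → Fin (S.card + k)}
    (hc : ∀ i, ∃ x, x ∉ S ∧ c x = i)
    (hadj : ∀ x y, x ∉ S → y ∉ S → G.Adj x y → c x = c y) :
    Nonempty (SimpleGraph.Iso G (extremalGraph n k)) := by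
  classical
  obtain ⟨m, hm⟩ : ∃ m, m = n - k - 2 := ⟨_, rfl⟩
  have hm2 : Even m := by
    rw [Nat.even_iff]
    have : n % 2 = k % 2 := hpar
    omega
  have hmR : (((n - k - 3 : ℕ) : ℝ)) = m - 1 := by
    rw [eq_sub_iff_add_eq]
    exact_mod_cast (by omega : n - k - 3 + 1 = m)
  obtain ⟨μ, hμ1, hμ2⟩ := exists_root_quotient_equation (n - k - 3) k
  have hμm : (m : ℝ) < μ := by rw [hmR] at hμ1; linarith
  have hm0 : (0 : ℝ) ≤ m := m.cast_nonneg
  have hμ0 : 0 < μ := by linarith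
  have hμρ : μ ≤ graphSpectralRadius G :=
    (le_graphSpectralRadius_extremalGraph hμ0 (by linarith) hμ2).trans hρ
  have hμ3 : μ - 1 = 2 * (k + 1) / μ + 2 * ((m : ℝ) - 1) / (μ + 2 - m) := by
    rwa [hmR, show μ + 1 - ((m : ℝ) - 1) = μ + 2 - m by ring] at hμ2
  -- Orders of the colour classes.
  obtain ⟨a, ha⟩ : ∃ a : Fin (S.card + k) → ℕ,
    ∀ i, a i = (Finset.univ.filter fun x => x ∉ S ∧ c x = i).card := ⟨_, fun _ => rfl⟩
  have ha1 : ∀ i, 1 ≤ a i := by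
    intro i
    rw [ha]
    obtain ⟨x, hx⟩ := hc i
    exact Finset.card_pos.2 ⟨x, by simpa using hx⟩
  have hasum : ∑ i, a i + S.card = n := by
    have h1 := Finset.card_eq_sum_card_fiberwise (s := Sᶜ) (t := Finset.univ) (f := c)
      (fun x _ => Finset.mem_coe.2 (Finset.mem_univ _))
    have h2 := Finset.card_add_card_compl S
    rw [hcard, h1] at h2
    rw [← h2, add_comm]
    congr 1
    refine Finset.sum_congr rfl fun i _ => ?_
    rw [ha]
    congr 1
    ext x; simp
  have hq : S.card + k ≤ ∑ i, a i := by
    have := Finset.card_nsmul_le_sum Finset.univ a 1 fun i _ => ha1 i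
    simpa using this
  obtain ⟨T, hT⟩ : ∃ T, T + 2 * S.card = m + 3 := ⟨m + 3 - 2 * S.card, by omega⟩
  have hTm : (T : ℝ) < μ + 1 := by
    have : (T : ℝ) ≤ m := by exact_mod_cast (by omega : T ≤ m)
    linarith
  obtain ⟨b1, b2, b3⟩ := sum_div_le_of_sum_eq (q := S.card + k) (by omega) ha1
    (T := T) (by omega) hμ0 hTm
  have haμ : ∀ i, (a i : ℝ) < μ + 1 := fun i =>
    lt_of_le_of_lt (by exact_mod_cast b1 i) hTm
  have hsR : (2 : ℝ) ≤ S.card := by exact_mod_cast hS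
  have b2' := mul_le_mul_of_nonneg_left b2 (show (0 : ℝ) ≤ S.card by linarith)
  have hbound : S.card = 2 → ((S.card : ℝ) - 1) + S.card *
      ((((S.card + k : ℕ) : ℝ) - 1) / μ + T / (μ + 1 - T)) = μ := by
    intro h2
    have hTR : (T : ℝ) = m - 1 := by
      rw [eq_sub_iff_add_eq]
      exact_mod_cast (by omega : T + 1 = m)
    rw [h2, hTR]
    push_cast
    rw [show μ + 1 - ((m : ℝ) - 1) = μ + 2 - m by ring]
    linear_combination -hμ3
  have hbound3 : 3 ≤ S.card → ((S.card : ℝ) - 1) + S.card *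
      ((((S.card + k : ℕ) : ℝ) - 1) / μ + T / (μ + 1 - T)) < μ := by
    intro h3
    have := bound_lt_of_three_le (k := k) (by omega) hm2 h3 hT (by omega) hμm hμ3
    push_cast
    exact this
  obtain ⟨x, hx⟩ : ∃ x : V → ℝ, ∀ v, x v = if v ∈ S then 1 else S.card / (μ + 1 - a (c v)) :=
    ⟨_, fun _ => rfl⟩
  have hsumadj := sum_adj_separationGraph S c ha haμ hx
  obtain ⟨u, hu⟩ : S.Nonempty := Finset.card_pos.1 (by omega)
  have : Nonempty V := ⟨u⟩
  have hle : G ≤ separationGraph S c := by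
    intro v w hvw
    refine ⟨hvw.ne, ?_⟩
    by_cases hv : v ∈ S
    · exact .inl hv
    · by_cases hw : w ∈ S
      · exact .inr (.inl hw)
      · exact .inr (.inr (hadj v w hv hw hvw))
  obtain ⟨hG, heq⟩ := eq_and_sum_adj_eq_of_le_graphSpectralRadius (x := x) (μ := μ) hle
    (separationGraph_connected ⟨u, hu⟩ c)
    (fun v => by
      rw [hx]
      split_ifs
      · exact one_pos
      · exact div_pos (by linarith) (by linarith [haμ (c v)]))
    (fun v => by
      rw [hsumadj]
      split_ifs with hv
      · rw [hx, if_pos hv, mul_one]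
        rcases hS.lt_or_eq with h | h
        · linarith [hbound3 h]
        · linarith [hbound h.symm]
      · exact le_rfl) hμρ
  have hequ := heq u
  rw [hsumadj, if_pos hu, hx, if_pos hu, mul_one] at hequ
  rcases hS.lt_or_eq with h | h
  · linarith [hbound3 h]
  · have h2 := hbound h.symm
    have hsum : ∑ i, (a i : ℝ) / (μ + 1 - a i)
        = (((S.card + k : ℕ) : ℝ) - 1) / μ + T / (μ + 1 - T) := by
      refine mul_left_cancel₀ (show (S.card : ℝ) ≠ 0 by linarith) ?_
      linarith
    obtain ⟨i₀, hi₀⟩ := b3 (by omega) hsum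
    rw [hG]
    exact nonempty_iso_extremalGraph (by omega) (by omega) hcard h.symm hc
      (i₀ := i₀) (by rw [← ha, hi₀]; omega)

theorem theorem1 {V : Type*} [Fintype V] (G : SimpleGraph V) (n k : ℕ)
    (hcard : Fintype.card V = n) (hn : 5 * k + 6 ≤ n) (hpar : n ≡ k [MOD 2])
    (hρ : graphSpectralRadius (extremalGraph n k) ≤ graphSpectralRadius G)
    (hG : ¬ Nonempty (SimpleGraph.Iso G (extremalGraph n k))) :
    ∀ e ∈ G.edgeSet, ∃ M : G.Subgraph,
      M.IsMatching ∧ M.edgeSet.ncard = (n - k) / 2 ∧ e ∈ M.edgeSet := by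
  intro e he
  induction e with
  | _ u v =>
    rcases exists_matching_through_edge_or_separation G k (by omega)
      (by rw [hcard]; exact hpar) he with h | ⟨S, hS, c, hc, hadj⟩
    · rwa [hcard] at h
    · exact absurd (nonempty_iso_of_separation G n k hcard hn hpar hρ hS hc hadj) hG
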